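/- Let $n$ and $m$ be positive integers. A lazy shelf shuffle with $n$ cards and $m$ shelves is the following random rearrangement of a deck whose cards are labelled $1,2,\dots,n$ from top to bottom. There are $m+1$ shelves, numbered $0,1,\dots,m$ from top to bottom, all initially empty. The cards are dealt one at a time in the order $1,2,\dots,n$; independently and uniformly at random, each card receives one of $2m+1$ possible placements: either it is put on shelf $0$, below all cards already there, or, for one of the shelves $j\in\{1,\dots,m\}$, it is put on shelf $j$ above all cards already there, or on shelf $j$ below all cards already there. (So each of the $(2m+1)^n$ sequences of placements has probability $(2m+1)^{-n}$.) Finally the piles are stacked, with the pile of shelf $0$ on top, then the pile of shelf $1$, and so on down to shelf $m$. The resulting permutation $\pi\in S_n$ is given by letting $\pi(i)$ be the label of the $i$-th card from the top of the final deck. Then the expected number of fixed points of $\pi$ is equal to $$1+2\sum_{k=1}^{(n-1)/2}\frac{1}{(2m+1)^{2k}}\quad\text{if } n \text{ is odd},$$ $$1+2\sum_{k=1}^{n/2-1}\frac{1}{(2m+1)^{2k}}+\frac{1}{(2m+1)^{n}}\quad\text{if } n \text{ is even}.$$ -/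

import Mathlib

namespace LazyShelf

/-- What the `m`-shelf machine in lazy mode may do with one card. The value `none` means that the
card goes to shelf 0 (the lazy shelf), necessarily below the cards already there. The value
`some (j, true)` means on top of, and `some (j, false)` means below, the cards already on the
ordinary shelf `j + 1`. There are `2 * m + 1` placements. -/
abbrev Placement (m : ℕ) : Type := Option (Fin m × Bool)

/-- The shelf (among shelves `0, 1, …, m`, from top to bottom) used by a placement. -/
def Placement.shelf {m : ℕ} : Placement m → Fin (m + 1)
  | none => 0
  | some (j, _) => j.succ

/-- Put card `c` on a pile, a list of cards read from top to bottom, at the side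
required by the placement. -/
def putOnPile {n m : ℕ} (p : Placement m) (c : Fin n) (pile : List (Fin n)) : List (Fin n) :=
  match p with
  | none => pile ++ [c]
  | some (_, false) => pile ++ [c]
  | some (_, true) => c :: pile

/-- One step of the machine: card `c` is put on its shelf, the other shelves stay unchanged. -/
def placeCard {n m : ℕ} (p : Placement m) (c : Fin n) (shelves : Fin (m + 1) → List (Fin n)) :
    Fin (m + 1) → List (Fin n) :=
  Function.update shelves p.shelf (putOnPile p c (shelves p.shelf))

/-- An outcome: the record of what the machine does with each of the `n` cards.
Cards are labelled `0, 1, …, n - 1` from top to bottom of the initial deck. -/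
abbrev Outcome (n m : ℕ) : Type := Fin n → Placement m

/-- The piles after the machine, starting from empty shelves, has placed the cards one at a time,
from the top card `0` of the deck to the bottom card `n - 1`. -/
def finalShelves {n m : ℕ} (f : Outcome n m) : Fin (m + 1) → List (Fin n) :=
  (List.finRange n).foldl (fun shelves c => placeCard (f c) c shelves) (fun _ => [])

/-- The shuffled deck, read from the top of the top shelf to the bottom of the bottom shelf. -/
def finalDeck {n m : ℕ} (f : Outcome n m) : List (Fin n) :=
  (List.finRange (m + 1)).flatMap (finalShelves f)

theorem count_flatMap_finRange {n k : ℕ} (a : Fin n) (g : Fin k → List (Fin n)) :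
    ((List.finRange k).flatMap g).count a = ∑ s, (g s).count a := by
  rw [List.count_flatMap, Fin.sum_univ_def]
  rfl

theorem count_putOnPile {n m : ℕ} (p : Placement m) (c a : Fin n) (pile : List (Fin n)) :
    (putOnPile p c pile).count a = pile.count a + [c].count a := by
  rcases p with _ | ⟨j, _ | _⟩ <;> simp [putOnPile, List.count_cons]

theorem sum_count_placeCard {n m : ℕ} (p : Placement m) (c a : Fin n)
    (g : Fin (m + 1) → List (Fin n)) :
    ∑ s, (placeCard p c g s).count a = ∑ s, (g s).count a + [c].count a := by
  rw [← Finset.add_sum_erase _ _ (Finset.mem_univ p.shelf),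
    ← Finset.add_sum_erase Finset.univ (fun s => (g s).count a) (Finset.mem_univ p.shelf)]
  have h : ∑ s ∈ Finset.univ.erase p.shelf, (placeCard p c g s).count a
      = ∑ s ∈ Finset.univ.erase p.shelf, (g s).count a := by
    refine Finset.sum_congr rfl fun s hs => ?_
    rw [placeCard, Function.update_of_ne (Finset.ne_of_mem_erase hs)]
  rw [h, placeCard, Function.update_self, count_putOnPile]
  omega

theorem sum_count_foldl {n m : ℕ} (f : Outcome n m) (a : Fin n) (l : List (Fin n))
    (g : Fin (m + 1) → List (Fin n)) :
    ∑ s, (l.foldl (fun shelves c => placeCard (f c) c shelves) g s).count a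
      = ∑ s, (g s).count a + l.count a := by
  induction l generalizing g with
  | nil => simp
  | cons c l ih =>
    rw [List.foldl_cons, ih, sum_count_placeCard]
    simp only [List.count_cons, List.count_nil]
    omega

/-- The shuffled deck contains every card exactly once. -/
theorem finalDeck_perm {n m : ℕ} (f : Outcome n m) : (finalDeck f).Perm (List.finRange n) := by
  rw [List.perm_iff_count]
  intro a
  rw [finalDeck, count_flatMap_finRange]
  unfold finalShelves
  rw [sum_count_foldl]
  simp

theorem finalDeck_length {n m : ℕ} (f : Outcome n m) : (finalDeck f).length = n := by
  simpa using (finalDeck_perm f).length_eq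

theorem finalDeck_nodup {n m : ℕ} (f : Outcome n m) : (finalDeck f).Nodup :=
  (finalDeck_perm f).nodup_iff.mpr (List.nodup_finRange n)

theorem mem_finalDeck {n m : ℕ} (f : Outcome n m) (a : Fin n) : a ∈ finalDeck f :=
  (finalDeck_perm f).mem_iff.mpr (List.mem_finRange a)

/-- The permutation obtained from an outcome: `shufflePerm f i` is the label of the card that is in
position `i` (from the top) of the shuffled deck. -/
def shufflePerm {n m : ℕ} (f : Outcome n m) : Equiv.Perm (Fin n) :=
  (finCongr (finalDeck_length f).symm).trans
    (List.Nodup.getEquivOfForallMemList (finalDeck f) (finalDeck_nodup f) (mem_finalDeck f))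

theorem shufflePerm_apply {n m : ℕ} (f : Outcome n m) (i : Fin n) :
    shufflePerm f i = (finalDeck f).get (i.cast (finalDeck_length f).symm) := rfl

/-- The distribution, on permutations of `n` cards, of a lazy shelf shuffle with `m` shelves: each
card independently gets one of the `2 * m + 1` placements with equal probability, so that all
outcomes are equally likely, and the outcome determines the permutation. -/
noncomputable def lazyShelfShuffle (n m : ℕ) : PMF (Equiv.Perm (Fin n)) :=
  (PMF.uniformOfFintype (Outcome n m)).map shufflePerm

/-- The number of fixed points of a permutation of the cards. -/
def numFixedPoints {n : ℕ} (π : Equiv.Perm (Fin n)) : ℕ :=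
  (Finset.univ.filter fun i => π i = i).card

/-- The average number of fixed points after a lazy shelf shuffle. -/
noncomputable def expectedFixedPoints (n m : ℕ) : ℝ :=
  ∑ π : Equiv.Perm (Fin n), (lazyShelfShuffle n m π).toReal * (numFixedPoints π : ℝ)

end LazyShelf

namespace LazyShelf

/-! Put q = 2m+1. A card's position is the number of cards above it, so card i is fixed iff exactly
i cards lie above it (`shufflePerm_eq_self_iff`). Once card i has placement v of rank r, the other
cards lie above it independently: k of the q placements achieve this for a smaller card and l for a
larger one, where (k, l) is (r+1, r) for r even and (r, r+1) for r odd. Hence the favourable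
outcomes are counted by the coefficient of X^i in (q-k+kX)^i (q-l+lX)^(n-1-i)
(`card_fixed_and_placement`).

Summed over i, this is the trace of the (n-1)-st symmetric power of a 2×2 matrix with eigenvalues q
and k-l = ±1, which is the sum of q^(n-1-j) (±1)^j over j < n (`diagonalSum_eq_of_eigenvalues`).
Averaging over the m+1 even and m odd ranks leaves q^(-j) for even j and q^(-j-1) for odd j. Equal
terms pair up, whence the factor 2. -/

/-! ### Traces of symmetric powers of a 2×2 matrix -/

open Polynomial in
/-- The trace of the action of a two-by-two matrix on homogeneous forms of degree `N`
in two variables. -/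
noncomputable def diagonalSum (a b c d : ℝ) (N : ℕ) : ℝ :=
  ∑ i ∈ Finset.range (N + 1), ((C a + C b * X) ^ i * (C c + C d * X) ^ (N - i)).coeff i

open Polynomial in
/-- The sum of the entries next to the diagonal, companion to `diagonalSum`. -/
noncomputable def subdiagonalSum (a b c d : ℝ) (N : ℕ) : ℝ :=
  ∑ i ∈ Finset.range N, ((C a + C b * X) ^ (i + 1) * (C c + C d * X) ^ (N - (i + 1))).coeff i

open Polynomial in
theorem coeff_succ_linear_mul (a b : ℝ) (p : ℝ[X]) (i : ℕ) :
    ((C a + C b * X) * p).coeff (i + 1) = a * p.coeff (i + 1) + b * p.coeff i := by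
  rw [add_mul, coeff_add, coeff_C_mul, mul_assoc, coeff_C_mul, coeff_X_mul]

open Polynomial in
theorem coeff_zero_linear_mul (a b : ℝ) (p : ℝ[X]) :
    ((C a + C b * X) * p).coeff 0 = a * p.coeff 0 := by
  simp [add_mul, mul_assoc]

-- Peel one factor `a + bX` off each product: its constant term leads to a diagonal entry of degree
-- `N`, its linear term to a subdiagonal one.
open Polynomial in
theorem subdiagonalSum_succ (a b c d : ℝ) (N : ℕ) :
    subdiagonalSum a b c d (N + 1) = a * diagonalSum a b c d N + b * subdiagonalSum a b c d N := by
  unfold subdiagonalSum diagonalSum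
  rw [Finset.sum_range_succ', Finset.sum_range_succ' _ N, mul_add, Finset.mul_sum, Finset.mul_sum,
    add_right_comm, ← Finset.sum_add_distrib]
  congr 1
  · refine Finset.sum_congr rfl fun i _ => ?_
    rw [pow_succ' _ (i + 1), mul_assoc, coeff_succ_linear_mul]
    simp only [Nat.add_sub_add_right]
  · rw [zero_add, pow_one, coeff_zero_linear_mul]
    simp

open Polynomial in
theorem diagonalSum_succ (a b c d : ℝ) (N : ℕ) :
    diagonalSum a b c d (N + 1) =
      c * diagonalSum a b c d N + d * subdiagonalSum a b c d N + b ^ (N + 1) := by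
  unfold subdiagonalSum diagonalSum
  rw [Finset.sum_range_succ _ (N + 1)]
  congr 1
  · rw [Finset.sum_range_succ', Finset.sum_range_succ' _ N, mul_add, Finset.mul_sum,
      Finset.mul_sum, add_right_comm, ← Finset.sum_add_distrib]
    congr 1
    · refine Finset.sum_congr rfl fun i hi => ?_
      have h : N + 1 - (i + 1) = N - (i + 1) + 1 := by
        have := Finset.mem_range.mp hi
        omega
      rw [h, pow_succ' _ (N - (i + 1)), mul_left_comm, coeff_succ_linear_mul]
    · rw [pow_zero, one_mul, one_mul, Nat.sub_zero, Nat.sub_zero, pow_succ', coeff_zero_linear_mul]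
  -- The last term has no factor `c + dX` to peel off; it contributes its leading coefficient.
  · have h : (C a + C b * X).natDegree ≤ 1 := by
      rw [add_comm]
      exact natDegree_linear_le
    have := coeff_pow_of_natDegree_le (m := N + 1) h
    rw [Nat.sub_self, pow_zero, mul_one]
    simpa using this

theorem diagonalSum_zero (a b c d : ℝ) : diagonalSum a b c d 0 = 1 := by
  simp [diagonalSum]

theorem diagonalSum_one (a b c d : ℝ) : diagonalSum a b c d 1 = b + c := by
  rw [diagonalSum_succ, diagonalSum_zero]
  simp [subdiagonalSum, add_comm]

/-- Eliminating `subdiagonalSum` and the power of `b` from the two recurrences leaves the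
characteristic equation, with trace `b + c` and determinant `b * c - a * d`. -/
theorem diagonalSum_add_two (a b c d : ℝ) (N : ℕ) :
    diagonalSum a b c d (N + 2) =
      (b + c) * diagonalSum a b c d (N + 1) - (b * c - a * d) * diagonalSum a b c d N := by
  rw [diagonalSum_succ _ _ _ _ (N + 1), subdiagonalSum_succ, diagonalSum_succ _ _ _ _ N]
  ring

/-- The diagonal sum is the complete homogeneous symmetric polynomial in the eigenvalues `q`
and `e`. -/
theorem diagonalSum_eq_of_eigenvalues {a b c d q e : ℝ} (hq : q ≠ 0) (htr : b + c = q + e)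
    (hdet : b * c - a * d = q * e) (N : ℕ) :
    diagonalSum a b c d N = q ^ N * ∑ j ∈ Finset.range (N + 1), (e / q) ^ j := by
  induction N using Nat.twoStepInduction with
  | zero => simp [diagonalSum_zero]
  | one =>
    rw [diagonalSum_one, htr, Finset.sum_range_succ, Finset.sum_range_one]
    field_simp
  | more N h₀ h₁ =>
    rw [diagonalSum_add_two, h₀, h₁, htr, hdet, Finset.sum_range_succ _ (N + 2),
      Finset.sum_range_succ _ (N + 1)]
    simp only [div_pow]
    field_simp
    ring

/-! ### The order of the cards in the final deck -/

/-- The rank of a placement: the placements listed in the order in which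
the corresponding groups of cards appear in the final deck. -/
def rank {m : ℕ} : Placement m → ℕ
  | none => 0
  | some (j, true) => 2 * j + 1
  | some (j, false) => 2 * j + 2

theorem rank_injective {m : ℕ} : Function.Injective (rank (m := m)) := by
  rintro (_ | ⟨j, _ | _⟩) (_ | ⟨k, _ | _⟩) h <;> simp only [rank] at h <;>
    first | rfl | omega | (congr 2; ext; omega)

theorem rank_lt {m : ℕ} (p : Placement m) : rank p < 2 * m + 1 := by
  rcases p with _ | ⟨j, _ | _⟩ <;> simp only [rank] <;> omega

theorem rank_lt_of_shelf_lt {m : ℕ} {p r : Placement m} (h : p.shelf < r.shelf) :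
    rank p < rank r := by
  rcases p with _ | ⟨j, _ | _⟩ <;> rcases r with _ | ⟨k, _ | _⟩ <;>
    simp only [rank, Placement.shelf, Fin.lt_def, Fin.val_succ, Fin.val_zero] at h ⊢ <;> omega

theorem image_rank (m : ℕ) :
    (Finset.univ : Finset (Placement m)).image rank = Finset.range (2 * m + 1) := by
  refine Finset.eq_of_subset_of_card_le (fun k hk => ?_) ?_
  · obtain ⟨p, -, rfl⟩ := Finset.mem_image.mp hk
    exact Finset.mem_range.mpr (rank_lt p)
  · rw [Finset.card_image_of_injective _ rank_injective]
    simp [mul_comm]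

theorem card_rank_lt {m k : ℕ} (hk : k ≤ 2 * m + 1) :
    (Finset.univ.filter fun p : Placement m => rank p < k).card = k := by
  rw [← Finset.card_image_of_injective _ rank_injective]
  have h := Finset.filter_image (s := (Finset.univ : Finset (Placement m))) (f := rank)
    (p := fun r => r < k)
  rw [← h, image_rank]
  have : (Finset.range (2 * m + 1)).filter (fun r => r < k) = Finset.range k := by
    ext r
    simp only [Finset.mem_filter, Finset.mem_range]
    omega
  rw [this, Finset.card_range]

/-- Card `b` placed by `p` ends up above card `a` placed by `r`. -/
def Above {n m : ℕ} (b : Fin n) (p : Placement m) (a : Fin n) (r : Placement m) : Prop :=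
  rank p < rank r ∨ rank p = rank r ∧ (if Even (rank r) then b < a else a < b)

instance {n m : ℕ} (b : Fin n) (p : Placement m) (a : Fin n) (r : Placement m) :
    Decidable (Above b p a r) := by
  unfold Above
  infer_instance

theorem not_above_self {n m : ℕ} (a : Fin n) (p : Placement m) : ¬ Above a p a p := by
  simp [Above]

theorem Above.not_above {n m : ℕ} {a b : Fin n} {p r : Placement m} (h : Above b p a r) :
    ¬ Above a r b p := by
  unfold Above at *
  rintro h'
  have e : rank p = rank r := by omega
  rw [e] at h h'
  simp only [lt_irrefl, false_or, true_and] at h h'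
  split_ifs at h h' <;> exact lt_asymm h h'

/-- Loop invariant of the dealing: every pile is sorted by `Above`, holds only cards of its own
shelf, and all of them are smaller than the cards still to come. -/
theorem pairwise_foldl_placeCard {n m : ℕ} (f : Outcome n m) (l : List (Fin n))
    (hl : l.Pairwise (· < ·)) (g : Fin (m + 1) → List (Fin n))
    (hlt : ∀ s, ∀ b ∈ g s, ∀ c ∈ l, b < c) (hs : ∀ s, ∀ b ∈ g s, (f b).shelf = s)
    (hp : ∀ s, (g s).Pairwise fun b a => Above b (f b) a (f a)) (s : Fin (m + 1)) :
    (∀ b ∈ l.foldl (fun shelves c => placeCard (f c) c shelves) g s, (f b).shelf = s) ∧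
    (l.foldl (fun shelves c => placeCard (f c) c shelves) g s).Pairwise
      fun b a => Above b (f b) a (f a) := by
  induction l generalizing g with
  | nil => exact ⟨hs s, hp s⟩
  | cons c l ih =>
    rw [List.foldl_cons]
    rw [List.pairwise_cons] at hl
    have hmem : ∀ t, ∀ b ∈ placeCard (f c) c g t, b ∈ g t ∨ b = c ∧ (f c).shelf = t := by
      intro t b hb
      by_cases ht : t = (f c).shelf
      · subst ht
        rw [placeCard, Function.update_self] at hb
        unfold putOnPile at hb
        split at hb <;> simp at hb <;> tauto
      · rw [placeCard, Function.update_of_ne ht] at hb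
        exact Or.inl hb
    refine ih hl.2 _ ?_ ?_ ?_
    · intro t b hb x hx
      rcases hmem t b hb with h | ⟨rfl, -⟩
      · exact hlt t b h x (List.mem_cons_of_mem _ hx)
      · exact hl.1 x hx
    · intro t b hb
      rcases hmem t b hb with h | ⟨rfl, h⟩
      · exact hs t b h
      · exact h
    · intro t
      by_cases ht : t = (f c).shelf
      · subst ht
        rw [placeCard, Function.update_self]
        have hlt' : ∀ b ∈ g (f c).shelf, b < c :=
          fun b hb => hlt _ b hb c List.mem_cons_self
        have hs' := hs (f c).shelf
        have hp' := hp (f c).shelf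
        generalize g (f c).shelf = pile at hlt' hs' hp'
        -- On one shelf the bottom placement has the larger, even rank and the top one the odd rank.
        -- Ties are settled by `c` being the newest, hence largest, card.
        have key : (∀ b ∈ pile, rank (f c) % 2 = 0 → Above b (f b) c (f c)) ∧
            (∀ b ∈ pile, rank (f c) % 2 = 1 → Above c (f c) b (f b)) := by
          constructor <;> intro b hb <;> have h1 := hlt' b hb <;> have h2 := hs' b hb <;>
            unfold Above <;> generalize f b = p at h2 ⊢ <;> generalize f c = r at h2 ⊢ <;>
            rcases p with _ | ⟨j, _ | _⟩ <;> rcases r with _ | ⟨k, _ | _⟩ <;>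
            simp only [rank, Placement.shelf, Fin.ext_iff, Fin.val_succ, Fin.val_zero,
              Nat.even_iff] at h2 ⊢ <;> intro h3 <;> split_ifs <;>
            first | omega | exact Or.inr ⟨trivial, h1⟩
        unfold putOnPile
        split
        · rename_i h
          rw [List.pairwise_append]
          refine ⟨hp', List.pairwise_singleton _ _, fun b hb a ha => ?_⟩
          rw [List.mem_singleton.mp ha]
          exact key.1 b hb (by simp [h, rank])
        · rename_i h
          rw [List.pairwise_append]
          refine ⟨hp', List.pairwise_singleton _ _, fun b hb a ha => ?_⟩
          rw [List.mem_singleton.mp ha]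
          exact key.1 b hb (by simp [h, rank])
        · rename_i h
          exact List.pairwise_cons.mpr ⟨fun b hb => key.2 b hb (by simp [h, rank]), hp'⟩
      · rw [placeCard, Function.update_of_ne ht]
        exact hp t

theorem pairwise_finalDeck {n m : ℕ} (f : Outcome n m) :
    (finalDeck f).Pairwise fun b a => Above b (f b) a (f a) := by
  have h := pairwise_foldl_placeCard f (List.finRange n) (List.pairwise_lt_finRange n)
    (fun _ => []) (by simp) (by simp) (by simp)
  rw [finalDeck, List.pairwise_flatMap]
  refine ⟨fun s _ => (h s).2, (List.pairwise_lt_finRange (m + 1)).imp fun {s t} hst b hb a ha => ?_⟩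
  refine Or.inl (rank_lt_of_shelf_lt ?_)
  rw [(h s).1 b hb, (h t).1 a ha]
  exact hst

/-- In a list sorted by an asymmetric relation, the position of an element is the number of its
predecessors. -/
theorem countP_getElem_of_pairwise {α : Type*} (R : α → α → Prop) [DecidableRel R]
    (hR : ∀ a b, R a b → ¬ R b a) (l : List α) (hl : l.Pairwise R) (i : ℕ) (hi : i < l.length) :
    l.countP (fun b => R b l[i]) = i := by
  induction l generalizing i with
  | nil => simp at hi
  | cons x l ih =>
    rw [List.pairwise_cons] at hl
    cases i with
    | zero =>
      rw [List.countP_eq_zero]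
      intro b hb
      simp only [List.getElem_cons_zero, decide_eq_true_eq]
      rcases List.mem_cons.mp hb with rfl | hb
      · exact fun h => hR _ _ h h
      · exact hR _ _ (hl.1 b hb)
    | succ i =>
      have hi' : i < l.length := by simpa using hi
      rw [List.countP_cons]
      simp only [List.getElem_cons_succ]
      rw [ih hl.2 i hi', if_pos]
      exact decide_eq_true (hl.1 _ (List.getElem_mem hi'))

theorem card_above_shufflePerm {n m : ℕ} (f : Outcome n m) (i : Fin n) :
    (Finset.univ.filter fun b => Above b (f b) (shufflePerm f i) (f (shufflePerm f i))).card
      = i := by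
  have hi : (i : ℕ) < (finalDeck f).length := by rw [finalDeck_length]; exact i.2
  have h := countP_getElem_of_pairwise (fun b a => Above b (f b) a (f a))
    (fun a b h => h.not_above) _ (pairwise_finalDeck f) i hi
  rw [(finalDeck_perm f).countP_eq] at h
  have e : shufflePerm f i = (finalDeck f)[(i : ℕ)] := rfl
  rw [e]
  conv_rhs => rw [← h]
  rw [List.countP_eq_length_filter, Fin.univ_def]
  simp [Finset.filter, Finset.card]

/-- For the converse, card `i` is in some position `k`, and its count of cards above is then `k`. -/
theorem shufflePerm_eq_self_iff {n m : ℕ} (f : Outcome n m) (i : Fin n) :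
    shufflePerm f i = i ↔ (Finset.univ.filter fun b => Above b (f b) i (f i)).card = i := by
  constructor
  · intro h
    have := card_above_shufflePerm f i
    rwa [h] at this
  · intro h
    obtain ⟨k, rfl⟩ := (shufflePerm f).surjective i
    rw [card_above_shufflePerm] at h
    exact congrArg _ (Fin.ext h).symm

/-! ### Counting outcomes by generating polynomials -/

/-- The number of placements that send card `b` above card `i` placed by `v`. -/
theorem card_above {n m : ℕ} {b i : Fin n} (hb : b ≠ i) (v : Placement m) :
    (Finset.univ.filter fun p => Above b p i v).card =
      if (b < i ↔ Even (rank v)) then rank v + 1 else rank v := by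
  have hv := rank_lt v
  -- Smaller ranks always count; `v` itself counts exactly when the tie-break favours `b`.
  split_ifs with h
  · rw [← card_rank_lt (m := m) (k := rank v + 1) (by omega)]
    congr 1
    ext p
    simp only [Finset.mem_filter, Finset.mem_univ, true_and]
    unfold Above
    have : (if Even (rank v) then b < i else i < b) := by
      split_ifs with h'
      · exact h.mpr h'
      · exact lt_of_le_of_ne (not_lt.mp fun h'' => h' (h.mp h'')) hb.symm
    rw [and_iff_left this]
    omega
  · conv_rhs => rw [← card_rank_lt (m := m) (k := rank v) (by omega)]
    congr 1
    ext p
    simp only [Finset.mem_filter, Finset.mem_univ, true_and]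
    unfold Above
    have : ¬ (if Even (rank v) then b < i else i < b) := by
      split_ifs with h'
      · exact fun h'' => h (iff_of_true h'' h')
      · exact fun h'' => h (iff_of_false h''.not_gt h')
    simp only [this, and_false, or_false]

open Polynomial in
/-- Summing over the placement of one card. -/
theorem sum_ite_above {n m : ℕ} {b i : Fin n} (v : Placement m) (k : ℕ)
    (hk : (Finset.univ.filter fun p => Above b p i v).card = k) :
    ∑ p : Placement m, (if Above b p i v then X else 1 : ℝ[X]) =
      C (2 * (m : ℝ) + 1 - k) + C (k : ℝ) * X := by
  rw [Finset.sum_ite, Finset.sum_const, Finset.sum_const, hk]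
  have h := Finset.card_filter_add_card_filter_not (s := (Finset.univ : Finset (Placement m)))
    (fun p => Above b p i v)
  rw [hk] at h
  have h2 : ((Finset.univ.filter fun p => ¬ Above b p i v).card : ℝ) = 2 * (m : ℝ) + 1 - k := by
    rw [eq_sub_iff_add_eq, add_comm]
    have : (Finset.univ : Finset (Placement m)).card = 2 * m + 1 := by simp [mul_comm]
    rw [this] at h
    exact_mod_cast h
  rw [← h2, add_comm, nsmul_eq_mul, nsmul_eq_mul, mul_one]
  simp

open Polynomial in
theorem card_fixed_and_placement {n m : ℕ} (i : Fin n) (v : Placement m) (k l : ℕ)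
    (hk : ∀ b < i, (Finset.univ.filter fun p => Above b p i v).card = k)
    (hl : ∀ b, i < b → (Finset.univ.filter fun p => Above b p i v).card = l) :
    ((Finset.univ.filter fun f : Outcome n m => shufflePerm f i = i ∧ f i = v).card : ℝ) =
      ((C (2 * (m : ℝ) + 1 - k) + C (k : ℝ) * X) ^ (i : ℕ) *
        (C (2 * (m : ℝ) + 1 - l) + C (l : ℝ) * X) ^ (n - 1 - i)).coeff i := by
  -- `X` marks a card above `i`; the weight at `i` forces the placement `v`.
  let w : Fin n → Placement m → ℝ[X] := fun b p =>
    if b = i then (if p = v then 1 else 0) else (if Above b p i v then X else 1)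
  have hprod : ∀ f : Outcome n m, ∏ b, w b (f b) =
      if f i = v then X ^ (Finset.univ.filter fun b => Above b (f b) i v).card else 0 := by
    intro f
    split_ifs with h
    · rw [Finset.card_eq_sum_ones, Finset.sum_filter, ← Finset.prod_pow_eq_pow_sum]
      refine Finset.prod_congr rfl fun b _ => ?_
      by_cases hb : b = i
      · subst hb
        simp [w, h, not_above_self]
      · simp only [w, if_neg hb]
        split_ifs <;> simp
    · refine Finset.prod_eq_zero (Finset.mem_univ i) ?_
      simp [w, h]
  have hsum : ∀ b, ∑ p, w b p = (if b < i then C (2 * (m : ℝ) + 1 - k) + C (k : ℝ) * X else 1) *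
      (if i < b then C (2 * (m : ℝ) + 1 - l) + C (l : ℝ) * X else 1) := by
    intro b
    rcases lt_trichotomy b i with h | h | h
    · simp only [w, h.ne, if_false, h, if_true, h.not_gt, mul_one]
      exact sum_ite_above v k (hk b h)
    · simp [w, h]
    · simp only [w, h.ne', if_false, h, if_true, h.not_gt, one_mul]
      exact sum_ite_above v l (hl b h)
  -- Independence of the cards: the product of the one-card sums expands into a sum over all
  -- outcomes.
  have key := Finset.prod_univ_sum (fun _ : Fin n => (Finset.univ : Finset (Placement m))) w
  simp only [hsum, Fintype.piFinset_univ, hprod, Finset.prod_mul_distrib, Finset.prod_ite,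
    Finset.prod_const_one, mul_one, Finset.prod_const] at key
  have h1 : (Finset.univ.filter fun b => b < i).card = (i : ℕ) := by
    rw [Finset.filter_gt_eq_Iio, Fin.card_Iio]
  have h2 : (Finset.univ.filter fun b => i < b).card = n - 1 - i := by
    rw [Finset.filter_lt_eq_Ioi, Fin.card_Ioi]
  rw [h1, h2] at key
  rw [key, finsetSum_coeff, Finset.card_filter, Nat.cast_sum]
  refine Finset.sum_congr rfl fun f _ => ?_
  simp only [shufflePerm_eq_self_iff]
  by_cases h : f i = v
  · simp only [h, and_true, if_true, coeff_X_pow, eq_comm]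
    split_ifs <;> simp
  · simp [h]

/-- The fixed points over all outcomes, counted by the placement `v` of the fixed card. -/
theorem sum_card_fixed_and_placement {n m : ℕ} (v : Placement m) :
    ∑ i : Fin (n + 1), ((Finset.univ.filter fun f : Outcome (n + 1) m =>
        shufflePerm f i = i ∧ f i = v).card : ℝ) =
      (2 * (m : ℝ) + 1) ^ n * ∑ j ∈ Finset.range (n + 1),
        ((if Even (rank v) then 1 else -1) / (2 * (m : ℝ) + 1)) ^ j := by
  have hq : (2 * (m : ℝ) + 1) ≠ 0 := by positivity
  -- The parity decides whether smaller or larger cards get the extra placement, so the second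
  -- eigenvalue is 1 or -1.
  by_cases hv : Even (rank v)
  · rw [if_pos hv, ← diagonalSum_eq_of_eigenvalues (a := 2 * (m : ℝ) + 1 - (rank v + 1 : ℕ))
      (b := (rank v + 1 : ℕ)) (c := 2 * (m : ℝ) + 1 - rank v) (d := rank v) hq
      (by push_cast; ring) (by push_cast; ring), diagonalSum, Finset.sum_range]
    refine Finset.sum_congr rfl fun i _ => ?_
    refine card_fixed_and_placement i v _ _ (fun b hb => ?_) (fun b hb => ?_)
    · rw [card_above hb.ne, if_pos (iff_of_true hb hv)]
    · rw [card_above hb.ne', if_neg (fun h => hb.not_gt (h.mpr hv))]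
  · rw [if_neg hv, ← diagonalSum_eq_of_eigenvalues (a := 2 * (m : ℝ) + 1 - rank v)
      (b := rank v) (c := 2 * (m : ℝ) + 1 - (rank v + 1 : ℕ)) (d := (rank v + 1 : ℕ)) hq
      (by push_cast; ring) (by push_cast; ring), diagonalSum, Finset.sum_range]
    refine Finset.sum_congr rfl fun i _ => ?_
    refine card_fixed_and_placement i v _ _ (fun b hb => ?_) (fun b hb => ?_)
    · rw [card_above hb.ne, if_neg (fun h => hv (h.mp hb))]
    · rw [card_above hb.ne', if_pos (iff_of_false hb.not_gt hv)]

/-! ### Evaluation of the expectation -/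

theorem expectedFixedPoints_eq_sum_outcomes (n m : ℕ) :
    expectedFixedPoints n m =
      (∑ f : Outcome n m, (numFixedPoints (shufflePerm f) : ℝ)) / (2 * (m : ℝ) + 1) ^ n := by
  have hcard : (Fintype.card (Outcome n m) : ℝ) = (2 * (m : ℝ) + 1) ^ n := by
    simp [mul_comm]
  have hprob : ∀ π, (lazyShelfShuffle n m π).toReal =
      ∑ f : Outcome n m, if π = shufflePerm f then ((2 * (m : ℝ) + 1) ^ n)⁻¹ else 0 := by
    intro π
    rw [lazyShelfShuffle, PMF.map_apply, tsum_fintype, ENNReal.toReal_sum]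
    · refine Finset.sum_congr rfl fun f _ => ?_
      split_ifs
      · rw [PMF.uniformOfFintype_apply, ENNReal.toReal_inv, ENNReal.toReal_natCast, hcard]
      · rfl
    · intro f _
      split_ifs
      · exact PMF.apply_ne_top _ _
      · exact ENNReal.zero_ne_top
  unfold expectedFixedPoints
  simp only [hprob, Finset.sum_mul]
  rw [Finset.sum_comm, Finset.sum_div]
  refine Finset.sum_congr rfl fun f _ => ?_
  simp only [ite_mul, zero_mul, Finset.sum_ite_eq', Finset.mem_univ, if_true]
  rw [div_eq_inv_mul]

theorem sum_numFixedPoints (n m : ℕ) :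
    ∑ f : Outcome n m, (numFixedPoints (shufflePerm f) : ℝ) =
      ∑ v : Placement m, ∑ i : Fin n, ((Finset.univ.filter fun f : Outcome n m =>
        shufflePerm f i = i ∧ f i = v).card : ℝ) := by
  have h : ∀ f : Outcome n m, (numFixedPoints (shufflePerm f) : ℝ) =
      ∑ v : Placement m, ∑ i : Fin n, if shufflePerm f i = i ∧ f i = v then 1 else 0 := by
    intro f
    rw [Finset.sum_comm, numFixedPoints, Finset.card_filter, Nat.cast_sum]
    refine Finset.sum_congr rfl fun i _ => ?_
    by_cases hi : shufflePerm f i = i <;> simp [hi]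
  simp only [h, Finset.card_filter, Nat.cast_sum, Nat.cast_ite, Nat.cast_one, Nat.cast_zero]
  rw [Finset.sum_comm]
  exact Finset.sum_congr rfl fun v _ => Finset.sum_comm

/-- The `m + 1` even ranks are shelf 0 and the bottom placements; the `m` odd ranks are the top
placements. -/
theorem expectedFixedPoints_succ (n m : ℕ) :
    expectedFixedPoints (n + 1) m =
      ((m + 1) * ∑ j ∈ Finset.range (n + 1), (1 / (2 * (m : ℝ) + 1)) ^ j +
        m * ∑ j ∈ Finset.range (n + 1), (-1 / (2 * (m : ℝ) + 1)) ^ j) / (2 * (m : ℝ) + 1) := by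
  have hq : (2 * (m : ℝ) + 1) ≠ 0 := by positivity
  rw [expectedFixedPoints_eq_sum_outcomes, sum_numFixedPoints]
  simp only [sum_card_fixed_and_placement]
  rw [← Finset.mul_sum, pow_succ, mul_div_mul_left _ _ (pow_ne_zero n hq)]
  congr 1
  have hodd : ∀ j : ℕ, ¬ Even (2 * j + 1) := fun j => by simp
  have heven : ∀ j : ℕ, Even (2 * j + 2) := fun j => by simp [Nat.even_add]
  simp only [Fintype.sum_option, Fintype.sum_prod_type, Fintype.sum_bool, rank, hodd, heven,
    if_true, if_false, Even.zero, Finset.sum_const, Finset.card_univ, Fintype.card_fin,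
    nsmul_eq_mul]
  ring

theorem expectedFixedPoints_one (m : ℕ) : expectedFixedPoints 1 m = 1 := by
  have hq : (2 * (m : ℝ) + 1) ≠ 0 := by positivity
  rw [expectedFixedPoints_succ]
  simp only [zero_add, Finset.sum_range_one, pow_zero]
  field_simp
  ring

/-- The new index `j = 2r+1` is odd, so its weight is `(m + 1) - m = 1`, and the outer denominator
supplies one more power. -/
theorem expectedFixedPoints_even (r m : ℕ) :
    expectedFixedPoints (2 * r + 2) m =
      expectedFixedPoints (2 * r + 1) m + 1 / (2 * (m : ℝ) + 1) ^ (2 * r + 2) := by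
  have hq : (2 * (m : ℝ) + 1) ≠ 0 := by positivity
  rw [expectedFixedPoints_succ, expectedFixedPoints_succ, Finset.sum_range_succ _ (2 * r + 1),
    Finset.sum_range_succ _ (2 * r + 1), div_pow, div_pow,
    (show Odd (2 * r + 1) from ⟨r, rfl⟩).neg_one_pow, one_pow]
  field_simp
  ring

/-- The new index `j = 2r+2` is even, so its weight `(m + 1) + m` cancels the outer denominator. The
increment equals that of the preceding step. -/
theorem expectedFixedPoints_odd (r m : ℕ) :
    expectedFixedPoints (2 * r + 3) m =
      expectedFixedPoints (2 * r + 2) m + 1 / (2 * (m : ℝ) + 1) ^ (2 * r + 2) := by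
  have hq : (2 * (m : ℝ) + 1) ≠ 0 := by positivity
  rw [expectedFixedPoints_succ, expectedFixedPoints_succ, Finset.sum_range_succ _ (2 * r + 2),
    Finset.sum_range_succ _ (2 * r + 2), div_pow, div_pow,
    (show Even (2 * r + 2) from ⟨r + 1, by ring⟩).neg_one_pow, one_pow]
  field_simp
  ring

theorem expectedFixedPoints_two_mul_add_one (r m : ℕ) :
    expectedFixedPoints (2 * r + 1) m =
      1 + 2 * ∑ k ∈ Finset.Icc 1 r, 1 / (2 * (m : ℝ) + 1) ^ (2 * k) := by
  induction r with
  | zero => simp [expectedFixedPoints_one]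
  | succ r ih =>
    rw [Finset.sum_Icc_succ_top (by omega), show 2 * (r + 1) + 1 = 2 * r + 3 by ring,
      expectedFixedPoints_odd, expectedFixedPoints_even, ih, show 2 * (r + 1) = 2 * r + 2 by ring]
    ring

end LazyShelf

theorem proposition5p2 (n m : ℕ) (hn : 0 < n) (hm : 0 < m) :
    (Odd n → LazyShelf.expectedFixedPoints n m =
      1 + 2 * ∑ k ∈ Finset.Icc 1 ((n - 1) / 2), 1 / (2 * (m : ℝ) + 1) ^ (2 * k)) ∧
    (Even n → LazyShelf.expectedFixedPoints n m =
      1 + 2 * ∑ k ∈ Finset.Icc 1 (n / 2 - 1), 1 / (2 * (m : ℝ) + 1) ^ (2 * k)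
        + 1 / (2 * (m : ℝ) + 1) ^ n) := by
  constructor
  · rintro ⟨r, rfl⟩
    rw [LazyShelf.expectedFixedPoints_two_mul_add_one, show (2 * r + 1 - 1) / 2 = r by omega]
  · rintro ⟨r, rfl⟩
    obtain ⟨r, rfl⟩ : ∃ s, r = s + 1 := ⟨r - 1, by omega⟩
    rw [show (r + 1 + (r + 1)) / 2 - 1 = r by omega, show r + 1 + (r + 1) = 2 * r + 2 by ring,
      LazyShelf.expectedFixedPoints_even, LazyShelf.expectedFixedPoints_two_mul_add_one]
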